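/- Let $n\ge 1$ be an integer. For a field $K$ and $a\in K^\times$ put $K_a=K[t]/(t^n-a)$. For a number field $K$ with ring of integers $\mathcal O_K$, let $\Delta(K_a/K)$ be the discriminant of the $K$-algebra $K_a$, that is, the ideal of $\mathcal O_K$ generated by $\det(\mathrm{Tr}_{K_a/K}(b_ib_j))_{i,j}$ for all $K$-bases $(b_i)$ of $K_a$ consisting of elements integral over $\mathcal O_K$. For a finite place $v$ of $K$ let $\mathfrak p_v$ be the corresponding prime ideal of $\mathcal O_K$ and $v(\cdot)$ the normalized valuation; write $v\mid n$ if $n\in\mathfrak p_v$, and $v\mid a$ if $v(a)\neq 0$. (1) For every number field $K$ there are a positive constant $C_{K,n}$, depending only on $K$ and $n$, and integers $e(a,v)$ with $0\le e(a,v)\le C_{K,n}$ for all $a\in K^\times$ and $v\mid n$, such that for all $a\in K^\times$ $$\Delta(K_a/K)=\prod_{v\nmid n,\ v\mid a}\mathfrak p_v^{\,n-\gcd(v(a),n)}\ \prod_{v\mid n}\mathfrak p_v^{\,e(a,v)}.$$ (2) For $K=\mathbb Q$ there are a positive constant $C_n$ and integers $0\le e(a,p)\le C_n$, for $a\in\mathbb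 Z\setminus\{0\}$ and primes $p\mid n$, such that for every nonzero $a\in\mathbb Z$ coprime to $n$ the following equalities of ideals of $\mathbb Z$ hold: $$\Delta(\mathbb Q_a/\mathbb Q)=\prod_{p\mid a}p^{\,n-\gcd(v_p(a),n)}\prod_{p\mid n}p^{\,e(a,p)},$$ and, if $a$ is squarefree, $$\Delta(\mathbb Q_a/\mathbb Q)=a^{n-1}\prod_{p\mid n}p^{\,e(a,p)}.$$ Moreover, if $a$ is squarefree, coprime to $n$, and $a\neq\pm1$, then $\mathbb Q_a$ is a field. -/

import Mathlib

open Polynomial IsDedekindDomain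
open scoped NumberField

noncomputable section

/-- The `K`-algebra `K_a = K[t]/(t^n - a)`. -/
abbrev kummerAlgebra (K : Type*) [Field K] (n : ℕ) (a : K) : Type _ :=
  AdjoinRoot (X ^ n - C a : K[X])

/-- The discriminant `Δ(L/K)` of a finite-dimensional commutative `K`-algebra `L`, with respect to
a subring of integers `A` of `K`: the ideal of `A` generated by the discriminants
`det (Tr_{L/K} (b i * b j))` of all `K`-bases `b` of `L` consisting of elements integral
over `A`. -/
def discrIdeal (A K L : Type*) [CommRing A] [Field K] [CommRing L] [Algebra A K] [Algebra K L]
    [Algebra A L] : Ideal A :=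
  Ideal.span {d : A | ∃ b : Module.Basis (Fin (Module.finrank K L)) K L,
    (∀ i, IsIntegral A (b i)) ∧ algebraMap A K d = Algebra.discr K b}

/-- The normalized additive valuation `v(x) ∈ ℤ` of `x ∈ Kˣ` at a finite place `v` of `K`.
Mathlib's multiplicative valuation of `x` is `exp (-v(x))`. -/
def placeOrd {K : Type*} [Field K] [NumberField K] (v : HeightOneSpectrum (𝓞 K)) (x : Kˣ) : ℤ :=
  -WithZero.log (v.valuation K (x : K))

end

/-!
The basis `1, t, …, t^(n-1)` of `K_a` has discriminant `± n^n a^(n-1)`. Let `x = ∑ c_k t^k` be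
integral. Applying to `x` the homomorphisms `t ↦ ζ^j β`, where `β^n = a` and `ζ` is a primitive
`n`-th root of unity, and inverting the resulting Fourier transform, one finds that `n c_k β^k` is
integral. Hence `n v(c_k) ≥ -k v(a)` at every place `v ∤ n`, that is, `v(c_k) ≥ -⌊k v(a) / n⌋`.
Conversely, if `π` is a uniformizer at `v`, the elements `π^(-⌊k v(a) / n⌋) t^k` are integral after
multiplication by suitable `v`-units. At `v ∤ n` this basis is therefore optimal, and the identity
`2 ∑_k ⌊k m / n⌋ = (n - 1) m - (n - gcd(m, n))` for `m = v(a)` yields the exponent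
`n - gcd(v(a), n)`. At `v ∣ n` the same basis bounds the exponent by `n + n v(n)`, uniformly in `a`.
-/

theorem mul_ediv_add_sub_mul_ediv {n : ℤ} (hn : 0 < n) (i m : ℤ) :
    i * m / n + (n - i) * m / n = m - 1 + if n ∣ i * m then 1 else 0 := by
  have hsub : (n - i) * m = -(i * m) + m * n := by ring
  rw [hsub, Int.add_mul_ediv_right _ _ hn.ne', Int.neg_ediv, Int.sign_eq_one_of_pos hn]
  split_ifs <;> ring

theorem card_filter_dvd_succ_mul {n : ℕ} (hn : n ≠ 0) (m : ℤ) :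
    ((Finset.range n).filter fun i : ℕ => (n : ℤ) ∣ ((i + 1 : ℕ) : ℤ) * m).card =
      Int.gcd m n := by
  have hdvd (i : ℕ) : (n : ℤ) ∣ ((i + 1 : ℕ) : ℤ) * m ↔ n / Int.gcd m n ∣ i + 1 := by
    rw [Int.natCast_dvd, Int.natAbs_mul, Int.natAbs_natCast, Int.gcd, Int.natAbs_natCast,
      Nat.div_dvd_iff_dvd_mul (Nat.gcd_dvd_right _ _)
        (Nat.gcd_pos_of_pos_right _ (Nat.pos_of_ne_zero hn)),
      mul_comm _ (i + 1), Nat.gcd_comm, Nat.dvd_mul_gcd_iff_dvd_mul]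
  simp only [hdvd]
  rw [Nat.card_multiples, Nat.div_div_self (Int.natCast_dvd_natCast.1 (Int.gcd_dvd_right _ _)) hn]

theorem two_mul_sum_mul_ediv {n : ℕ} (hn : n ≠ 0) (m : ℤ) :
    2 * ∑ i : Fin n, (i : ℤ) * m / n = (n - 1) * m - (n - Int.gcd m n) := by
  have hn' : (0 : ℤ) < n := by positivity
  let f (i : ℕ) : ℤ := (i : ℤ) * m / n
  -- Pair the indices `i + 1` and `n - 1 - i`, whose sum is `n`.
  have hpair : ∀ i ∈ Finset.range n, f (i + 1) + f (n - 1 - i) =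
      m - 1 + if (n : ℤ) ∣ ((i + 1 : ℕ) : ℤ) * m then 1 else 0 := by
    intro i hi
    have hsub : ((n - 1 - i : ℕ) : ℤ) = n - (i + 1 : ℕ) := by have := Finset.mem_range.1 hi; omega
    simp only [f, hsub, mul_ediv_add_sub_mul_ediv hn']
  have hshift : ∑ i ∈ Finset.range n, f (i + 1) = ∑ i ∈ Finset.range n, f i + m := by
    have h := Finset.sum_range_succ' f n
    have hfn : f n = m := Int.mul_ediv_cancel_left _ hn'.ne'
    have hf0 : f 0 = 0 := by simp [f]
    rw [Finset.sum_range_succ, hfn, hf0, add_zero] at h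
    exact h.symm
  have hsum := Finset.sum_congr rfl hpair
  rw [Finset.sum_add_distrib, Finset.sum_range_reflect, hshift, Finset.sum_add_distrib,
    Finset.sum_boole, card_filter_dvd_succ_mul hn, Finset.sum_const, Finset.card_range,
    nsmul_eq_mul] at hsum
  rw [Fin.sum_univ_eq_sum_range f]
  linear_combination hsum

theorem withZero_exp_sum {ι : Type*} (s : Finset ι) (f : ι → ℤ) :
    WithZero.exp (∑ i ∈ s, f i) = ∏ i ∈ s, WithZero.exp (f i) := by
  induction s using Finset.cons_induction with
  | empty => simp
  | cons i s hi ih => rw [Finset.sum_cons, Finset.prod_cons, WithZero.exp_add, ih]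

theorem prod_exp_mul_ediv_sq_mul {n : ℕ} (hn : n ≠ 0) (m : ℤ) :
    (∏ i : Fin n, WithZero.exp ((i : ℤ) * m / n)) ^ 2 * WithZero.exp (-m) ^ (n - 1) =
      WithZero.exp (-((n - Int.gcd m n : ℕ) : ℤ)) := by
  have hgcd : Int.gcd m n ≤ n := Nat.gcd_le_right _ (Nat.pos_of_ne_zero hn)
  rw [← withZero_exp_sum, ← WithZero.exp_nsmul, ← WithZero.exp_nsmul, ← WithZero.exp_add,
    nsmul_eq_mul, nsmul_eq_mul, Nat.cast_ofNat, two_mul_sum_mul_ediv hn, Nat.cast_sub hgcd,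
    Nat.cast_pred (Nat.pos_of_ne_zero hn)]
  congr 1
  ring

theorem le_exp_ediv_of_pow_le_exp {n : ℕ} (hn : n ≠ 0) {γ : WithZero (Multiplicative ℤ)} {z : ℤ}
    (h : γ ^ n ≤ WithZero.exp z) : γ ≤ WithZero.exp (z / n) := by
  rcases eq_or_ne γ 0 with rfl | hγ
  · exact zero_le
  · rw [← WithZero.exp_log hγ, ← WithZero.exp_nsmul, WithZero.exp_le_exp, nsmul_eq_mul] at h
    rw [← WithZero.exp_log hγ, WithZero.exp_le_exp, Int.le_ediv_iff_mul_le (by positivity)]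
    linarith

section Discriminant

theorem valuation_det_le_prod {R Γ ι : Type*} [CommRing R] [LinearOrderedCommGroupWithZero Γ]
    [Fintype ι] [DecidableEq ι] (w : Valuation R Γ) {M : Matrix ι ι R} {γ : ι → Γ}
    (hM : ∀ i j, w (M i j) ≤ γ i) : w M.det ≤ ∏ i, γ i := by
  rw [← Matrix.det_transpose, Matrix.det_apply]
  refine w.map_sum_le fun σ _ => ?_
  have hsign : w (Equiv.Perm.sign σ • ∏ i, M.transpose (σ i) i) = ∏ i, w (M i (σ i)) := by
    rcases Int.units_eq_one_or (Equiv.Perm.sign σ) with h | h <;> simp [h, Units.smul_def]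
  rw [hsign]
  exact Finset.prod_le_prod' fun i _ => hM i (σ i)

variable {R S ι κ : Type*} [CommRing R] [CommRing S] [Algebra R S] [Fintype ι] [DecidableEq ι]
  [Fintype κ] [DecidableEq κ]

theorem discr_unitsSMul (b : Module.Basis ι R S) (c : ι → Rˣ) :
    Algebra.discr R (b.unitsSMul c) = (∏ i, (c i : R)) ^ 2 * Algebra.discr R b := by
  rw [← b.toMatrix_map_vecMul (b.unitsSMul c), Algebra.discr_of_matrix_vecMul,
    Module.Basis.toMatrix_unitsSMul, Matrix.det_diagonal]
  rfl

theorem valuation_discr_le {Γ : Type*} [LinearOrderedCommGroupWithZero Γ] (w : Valuation R Γ)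
    (b : Module.Basis ι R S) (b' : Module.Basis κ R S) {γ : ι → Γ}
    (hγ : ∀ j i, w (b.repr (b' j) i) ≤ γ i) :
    w (Algebra.discr R b') ≤ (∏ i, γ i) ^ 2 * w (Algebra.discr R b) := by
  have : Nontrivial R := domain_nontrivial w (map_zero w) (map_one w)
  have hdet : w (b.toMatrix (b'.reindex (b'.indexEquiv b))).det ≤ ∏ i, γ i :=
    valuation_det_le_prod w fun i j => by
      rw [Module.Basis.toMatrix_apply, Module.Basis.reindex_apply]
      exact hγ _ i
  rw [← Algebra.discr_reindex R b' (b'.indexEquiv b), ← Module.Basis.coe_reindex,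
    ← b.toMatrix_map_vecMul (b'.reindex (b'.indexEquiv b)), Algebra.discr_of_matrix_vecMul,
    map_mul, map_pow]
  gcongr

end Discriminant

section KummerAlgebra

variable {K : Type*} [Field K]

/-- The class of `t` in `K[t]/(t^n - a)`, an `n`-th root of `a`. -/
noncomputable def kummerRoot (n : ℕ) (a : K) : kummerAlgebra K n a :=
  AdjoinRoot.root (X ^ n - C a)

theorem kummerRoot_pow_self (n : ℕ) (a : K) :
    kummerRoot n a ^ n = algebraMap K (kummerAlgebra K n a) a := by
  have h := AdjoinRoot.eval₂_root (X ^ n - C a : K[X])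
  rwa [eval₂_sub, eval₂_pow, eval₂_X, eval₂_C, sub_eq_zero] at h

variable (n : ℕ) [NeZero n] (a : K)

/-- The `K`-basis `1, t, …, t^(n-1)` of `K[t]/(t^n - a)`, the reference basis against which
discriminants of other bases are computed. -/
noncomputable def kummerBasis : Module.Basis (Fin n) K (kummerAlgebra K n a) :=
  (AdjoinRoot.powerBasis' (monic_X_pow_sub_C a (NeZero.ne n))).basis.reindex
    (finCongr natDegree_X_pow_sub_C)

theorem kummerBasis_apply (i : Fin n) : kummerBasis n a i = kummerRoot n a ^ (i : ℕ) := by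
  rw [kummerBasis, Module.Basis.reindex_apply, PowerBasis.basis_eq_pow]
  rfl

theorem kummerRoot_pow_eq_smul_kummerBasis (m : ℕ) :
    kummerRoot n a ^ m = a ^ (m / n) • kummerBasis n a (Fin.ofNat n m) := by
  rw [kummerBasis_apply, Fin.val_ofNat, Algebra.smul_def, map_pow, ← kummerRoot_pow_self,
    ← pow_mul, ← pow_add, Nat.div_add_mod]

theorem trace_kummerRoot_pow (m : ℕ) :
    Algebra.trace K (kummerAlgebra K n a) (kummerRoot n a ^ m) =
      if n ∣ m then n * a ^ (m / n) else 0 := by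
  have hcoord (i : Fin n) : (kummerBasis n a).repr (kummerRoot n a ^ m * kummerBasis n a i) i =
      if n ∣ m then a ^ (m / n) else 0 := by
    have hfix : Fin.ofNat n (m + i) = i ↔ n ∣ m := by
      rw [Fin.ext_iff, Fin.val_ofNat, ← Nat.modEq_zero_iff_dvd]
      nth_rw 2 [← Nat.mod_eq_of_lt i.2]
      nth_rw 2 [← Nat.zero_add (i : ℕ)]
      exact ⟨Nat.ModEq.add_right_cancel' i, Nat.ModEq.add_right i⟩
    rw [kummerBasis_apply, ← pow_add, kummerRoot_pow_eq_smul_kummerBasis, map_smul,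
      Module.Basis.repr_self, Finsupp.smul_apply, Finsupp.single_apply, smul_eq_mul, mul_ite,
      mul_one, mul_zero]
    simp only [hfix]
    refine if_ctx_congr Iff.rfl (fun h => ?_) fun _ => rfl
    rw [Nat.add_div_of_dvd_right h, Nat.div_eq_of_lt i.2, add_zero]
  rw [Algebra.trace_eq_matrix_trace (kummerBasis n a), Matrix.trace]
  simp only [Matrix.diag_apply, Algebra.leftMulMatrix_eq_repr_mul, hcoord, Finset.sum_const,
    Finset.card_univ, Fintype.card_fin, nsmul_eq_mul, mul_ite, mul_zero]

theorem traceMatrix_kummerBasis_submatrix_neg :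
    (Algebra.traceMatrix K (kummerBasis n a)).submatrix id (Equiv.neg (Fin n)) =
      Matrix.diagonal fun i => n * if i = 0 then 1 else a := by
  ext i j
  rw [Matrix.submatrix_apply, Algebra.traceMatrix_apply, Algebra.traceForm_apply,
    kummerBasis_apply, kummerBasis_apply, ← pow_add, trace_kummerRoot_pow, id, Equiv.neg_apply,
    Matrix.diagonal_apply]
  have hdvd : n ∣ (i : ℕ) + ((-j : Fin n) : ℕ) ↔ i = j := by
    rw [Nat.dvd_iff_mod_eq_zero, ← Fin.val_add, Fin.val_eq_zero_iff, add_neg_eq_zero]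
  simp only [hdvd]
  refine if_ctx_congr Iff.rfl (fun h => ?_) fun _ => rfl
  subst h
  rcases eq_or_ne i 0 with rfl | hi
  · simp
  · have hi' : (i : ℕ) ≠ 0 := Fin.val_ne_zero_iff.2 hi
    have hsum : (i : ℕ) + ((-i : Fin n) : ℕ) = n := by
      rw [Fin.val_neg', Nat.mod_eq_of_lt (by omega)]
      omega
    rw [hsum, Nat.div_self (NeZero.pos n), pow_one, if_neg hi]

theorem discr_kummerBasis :
    Algebra.discr K (kummerBasis n a) =
      ((Equiv.Perm.sign (Equiv.neg (Fin n)) : ℤ) : K) * (n ^ n * a ^ (n - 1)) := by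
  have hdet := congrArg Matrix.det (traceMatrix_kummerBasis_submatrix_neg n a)
  have hprod : ∏ i : Fin n, (if i = 0 then 1 else a) = a ^ (n - 1) := by
    rw [Finset.prod_ite, Finset.prod_const_one, one_mul, Finset.prod_const, Finset.filter_ne',
      Finset.card_erase_of_mem (Finset.mem_univ _), Finset.card_univ, Fintype.card_fin]
  rw [Matrix.det_permute', Matrix.det_diagonal, Finset.prod_mul_distrib, Finset.prod_const,
    Finset.card_univ, Fintype.card_fin, hprod] at hdet
  rw [Algebra.discr_def, ← hdet, ← mul_assoc, ← Int.cast_mul, ← Units.val_mul,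
    Int.units_mul_self, Units.val_one, Int.cast_one, one_mul]

variable {n a} in
theorem discr_kummerBasis_ne_zero (hn : (n : K) ≠ 0) (ha : a ≠ 0) :
    Algebra.discr K (kummerBasis n a) ≠ 0 := by
  rw [discr_kummerBasis]
  have hsign : ((Equiv.Perm.sign (Equiv.neg (Fin n)) : ℤ) : K) ≠ 0 := by
    rcases Int.units_eq_one_or (Equiv.Perm.sign (Equiv.neg (Fin n))) with h | h <;> simp [h]
  exact mul_ne_zero hsign (mul_ne_zero (pow_ne_zero _ hn) (pow_ne_zero _ ha))

theorem valuation_discr_kummerBasis {Γ : Type*} [LinearOrderedCommGroupWithZero Γ]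
    (w : Valuation K Γ) :
    w (Algebra.discr K (kummerBasis n a)) = w n ^ n * w a ^ (n - 1) := by
  have hsign : w ((Equiv.Perm.sign (Equiv.neg (Fin n)) : ℤ) : K) = 1 := by
    rcases Int.units_eq_one_or (Equiv.Perm.sign (Equiv.neg (Fin n))) with h | h <;> simp [h]
  rw [discr_kummerBasis, map_mul, hsign, one_mul, map_mul, map_pow, map_pow]

end KummerAlgebra

section FourierInversion

variable {E : Type*} [Field E] {n : ℕ} {ζ : E}

theorem geom_sum_pow_mul_inv_pow (hζ : IsPrimitiveRoot ζ n) (i k : Fin n) :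
    ∑ j ∈ Finset.range n, (ζ ^ (i : ℕ) * ζ⁻¹ ^ (k : ℕ)) ^ j = if i = k then (n : E) else 0 := by
  have hζ0 : ζ ≠ 0 := hζ.ne_zero (Nat.ne_zero_of_lt i.2)
  split_ifs with h
  · simp [h, hζ0]
  · have hpow : (ζ ^ (i : ℕ) * ζ⁻¹ ^ (k : ℕ)) ^ n = 1 := by
      rw [mul_pow, pow_right_comm, pow_right_comm ζ⁻¹, inv_pow, hζ.pow_eq_one]
      simp only [one_pow, inv_one, mul_one]
    have hne : ζ ^ (i : ℕ) * ζ⁻¹ ^ (k : ℕ) ≠ 1 := by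
      rw [inv_pow, Ne, mul_inv_eq_one₀ (pow_ne_zero _ hζ0)]
      exact fun heq => h (Fin.ext (hζ.pow_inj i.2 k.2 heq))
    have hgeom := geom_sum_mul (ζ ^ (i : ℕ) * ζ⁻¹ ^ (k : ℕ)) n
    rw [hpow, sub_self] at hgeom
    exact (mul_eq_zero.1 hgeom).resolve_right (sub_ne_zero.2 hne)

theorem fourier_inversion (hζ : IsPrimitiveRoot ζ n) (c : Fin n → E) (k : Fin n) :
    ∑ j ∈ Finset.range n, (ζ⁻¹ ^ (k : ℕ)) ^ j * ∑ i, c i * (ζ ^ j) ^ (i : ℕ) = n * c k := by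
  calc ∑ j ∈ Finset.range n, (ζ⁻¹ ^ (k : ℕ)) ^ j * ∑ i, c i * (ζ ^ j) ^ (i : ℕ)
      = ∑ i, c i * ∑ j ∈ Finset.range n, (ζ ^ (i : ℕ) * ζ⁻¹ ^ (k : ℕ)) ^ j := by
        simp only [Finset.mul_sum]
        rw [Finset.sum_comm]
        refine Finset.sum_congr rfl fun i _ => Finset.sum_congr rfl fun j _ => ?_
        rw [mul_pow, pow_right_comm ζ j]
        ring
    _ = n * c k := by
        simp only [geom_sum_pow_mul_inv_pow hζ, mul_ite, mul_zero, Finset.sum_ite_eq',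
          Finset.mem_univ, if_true, mul_comm]

end FourierInversion

section Integrality

variable {A K : Type*} [CommRing A] [Field K] [Algebra A K] {n : ℕ} {a : K}

/-- The `K`-algebra homomorphism `K[t]/(t^n - a) → E` sending `t` to a given `n`-th root `β`
of `a`. -/
noncomputable def kummerHom {E : Type*} [CommRing E] [Algebra K E] (β : E)
    (hβ : β ^ n = algebraMap K E a) : kummerAlgebra K n a →ₐ[K] E :=
  AdjoinRoot.liftAlgHom _ (Algebra.ofId K E) β (by simp [hβ])

variable [NeZero n]

theorem kummerHom_apply {E : Type*} [CommRing E] [Algebra K E] (β : E)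
    (hβ : β ^ n = algebraMap K E a) (x : kummerAlgebra K n a) :
    kummerHom β hβ x = ∑ i, algebraMap K E ((kummerBasis n a).repr x i) * β ^ (i : ℕ) := by
  have hroot : kummerHom β hβ (kummerRoot n a) = β := AdjoinRoot.liftAlgHom_root ..
  conv_lhs => rw [← (kummerBasis n a).sum_repr x]
  simp only [map_sum, kummerBasis_apply, Algebra.smul_def, map_mul, AlgHom.commutes, map_pow,
    hroot]

theorem isIntegral_natCast_mul_repr_mul_pow {E : Type*} [Field E] [Algebra K E] [Algebra A E]
    [IsScalarTower A K E] {ζ β : E} (hζ : IsPrimitiveRoot ζ n) (hβ : β ^ n = algebraMap K E a)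
    {x : kummerAlgebra K n a} (hx : IsIntegral A x) (k : Fin n) :
    IsIntegral A (n * (algebraMap K E ((kummerBasis n a).repr x k) * β ^ (k : ℕ))) := by
  have hconj (j : ℕ) : (ζ ^ j * β) ^ n = algebraMap K E a := by
    rw [mul_pow, pow_right_comm, hζ.pow_eq_one, one_pow, one_mul, hβ]
  have hζint : IsIntegral A ζ⁻¹ :=
    IsIntegral.of_pow (NeZero.pos n) (by rw [hζ.inv.pow_eq_one]; exact isIntegral_one)
  have hsum (j : ℕ) : kummerHom (ζ ^ j * β) (hconj j) x =
      ∑ i : Fin n, algebraMap K E ((kummerBasis n a).repr x i) * β ^ (i : ℕ) *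
        (ζ ^ j) ^ (i : ℕ) := by
    rw [kummerHom_apply]
    exact Finset.sum_congr rfl fun i _ => by rw [mul_pow, mul_assoc, mul_comm (β ^ _)]
  rw [← fourier_inversion hζ fun i => algebraMap K E ((kummerBasis n a).repr x i) * β ^ (i : ℕ)]
  refine IsIntegral.sum _ fun j _ => ((hζint.pow _).pow _).mul ?_
  rw [← hsum]
  exact hx.map ((kummerHom (ζ ^ j * β) (hconj j)).restrictScalars A)

theorem isIntegral_natCast_mul_repr_pow_mul_pow (hn : (n : K) ≠ 0) {x : kummerAlgebra K n a}
    (hx : IsIntegral A x) (k : Fin n) :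
    IsIntegral A ((n * (kummerBasis n a).repr x k) ^ n * a ^ (k : ℕ)) := by
  let E := AlgebraicClosure K
  have : NeZero (n : E) :=
    ⟨by simpa only [map_natCast] using (_root_.map_ne_zero (algebraMap K E)).2 hn⟩
  obtain ⟨ζ, hζ⟩ := HasEnoughRootsOfUnity.exists_primitiveRoot E n
  obtain ⟨β, hβ⟩ := IsAlgClosed.exists_pow_nat_eq (algebraMap K E a) (NeZero.pos n)
  have hpow := (isIntegral_natCast_mul_repr_mul_pow hζ hβ hx k).pow n
  rw [← mul_assoc, mul_pow _ (β ^ (k : ℕ)), pow_right_comm, hβ] at hpow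
  refine (isIntegral_algebraMap_iff (algebraMap K E).injective).1 ?_
  simpa only [map_mul, map_pow, map_natCast] using hpow

theorem trace_kummerAlgebra (x : kummerAlgebra K n a) :
    Algebra.trace K (kummerAlgebra K n a) x = n * (kummerBasis n a).repr x 0 := by
  conv_lhs => rw [← (kummerBasis n a).sum_repr x]
  rw [map_sum, Finset.sum_eq_single 0]
  · rw [map_smul, kummerBasis_apply, trace_kummerRoot_pow]
    simp [mul_comm]
  · intro i _ hi
    have hdvd : ¬ n ∣ (i : ℕ) :=
      Nat.not_dvd_of_pos_of_lt (Nat.pos_of_ne_zero (Fin.val_ne_zero_iff.2 hi)) i.2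
    rw [map_smul, kummerBasis_apply, trace_kummerRoot_pow, if_neg hdvd, smul_zero]
  · simp

theorem isIntegral_trace_kummerAlgebra (hn : (n : K) ≠ 0) {x : kummerAlgebra K n a}
    (hx : IsIntegral A x) : IsIntegral A (Algebra.trace K (kummerAlgebra K n a) x) := by
  rw [trace_kummerAlgebra]
  refine IsIntegral.of_pow (NeZero.pos n) ?_
  simpa using isIntegral_natCast_mul_repr_pow_mul_pow hn hx 0

theorem isIntegral_discr_kummerAlgebra (hn : (n : K) ≠ 0) {ι : Type*} [Fintype ι]
    [DecidableEq ι] {b : ι → kummerAlgebra K n a} (hb : ∀ i, IsIntegral A (b i)) :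
    IsIntegral A (Algebra.discr K b) :=
  IsIntegral.det fun i j => isIntegral_trace_kummerAlgebra hn ((hb i).mul (hb j))

theorem isIntegral_unitsSMul_kummerBasis {c : Fin n → Kˣ}
    (hc : ∀ i, IsIntegral A ((c i : K) ^ n * a ^ (i : ℕ))) (i : Fin n) :
    IsIntegral A ((kummerBasis n a).unitsSMul c i) := by
  have hpow : (kummerBasis n a).unitsSMul c i ^ n =
      algebraMap K (kummerAlgebra K n a) ((c i : K) ^ n * a ^ (i : ℕ)) := by
    rw [Module.Basis.unitsSMul_apply, kummerBasis_apply, Units.smul_def, Algebra.smul_def, mul_pow,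
      pow_right_comm, kummerRoot_pow_self, map_mul, map_pow, map_pow]
  refine IsIntegral.of_pow (NeZero.pos n) ?_
  rw [hpow]
  exact (hc i).algebraMap

end Integrality

section DiscrIdeal

variable {A K L : Type*} [CommRing A] [Field K] [Algebra A K] [CommRing L] [Algebra K L]
  [Algebra A L]

theorem mem_discrIdeal {ι : Type*} [Fintype ι] [DecidableEq ι] (b : Module.Basis ι K L)
    (hb : ∀ i, IsIntegral A (b i)) {d : A} (hd : algebraMap A K d = Algebra.discr K b) :
    d ∈ discrIdeal A K L := by
  let σ := Fintype.equivFinOfCardEq (Module.finrank_eq_card_basis b).symm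
  refine Ideal.subset_span ⟨b.reindex σ, fun i => ?_, ?_⟩
  · rw [Module.Basis.reindex_apply]
    exact hb _
  · rw [hd, Module.Basis.coe_reindex, Algebra.discr_reindex]

theorem discrIdeal_le_pow [IsDedekindDomain A] [IsFractionRing A K] (v : HeightOneSpectrum A)
    {k : ℕ} (h : ∀ b : Module.Basis (Fin (Module.finrank K L)) K L, (∀ i, IsIntegral A (b i)) →
      v.valuation K (Algebra.discr K b) ≤ WithZero.exp (-(k : ℤ))) :
    discrIdeal A K L ≤ v.asIdeal ^ k := by
  rw [discrIdeal, Ideal.span_le]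
  rintro d ⟨b, hb, hd⟩
  rw [SetLike.mem_coe, ← v.intValuation_le_pow_iff_mem, ← v.valuation_of_algebraMap (K := K)]
  exact (congrArg (v.valuation K) hd).trans_le (h b hb)

end DiscrIdeal

section Local

variable {A K : Type*} [CommRing A] [IsDedekindDomain A] [Field K] [Algebra A K]
  [IsFractionRing A K] (v : HeightOneSpectrum A)

/-- The normalized additive valuation `v(x)` of `x ∈ K` at a prime `v` of a Dedekind domain with
fraction field `K`. Restricted to the units of a number field it is `placeOrd`; its value at `0` is
the junk value `0`. -/
noncomputable def ordAt (x : K) : ℤ :=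
  -WithZero.log (v.valuation K x)

theorem valuation_eq_exp_neg_ordAt {x : K} (hx : x ≠ 0) :
    v.valuation K x = WithZero.exp (-ordAt v x) := by
  rw [ordAt, neg_neg, WithZero.exp_log ((Valuation.ne_zero_iff _).2 hx)]

theorem ordAt_algebraMap {x : A} (hx : x ≠ 0) :
    ordAt v (algebraMap A K x) = multiplicity v.asIdeal (Ideal.span {x}) := by
  have h : v.valuation K (algebraMap A K x) = v.intValuation x := v.valuation_of_algebraMap x
  rw [ordAt, h, v.intValuation_eq_exp_neg_multiplicity hx, WithZero.log_exp, neg_neg]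

theorem valuation_natCast_eq_one {n : ℕ} (hv : (n : A) ∉ v.asIdeal) :
    v.valuation K (n : K) = 1 := by
  simpa only [map_natCast] using (v.valuation_eq_one_iff_notMem (K := K)).2 hv

theorem valuation_le_one_of_isIntegral {x : K} (hx : IsIntegral A x) : v.valuation K x ≤ 1 := by
  obtain ⟨y, rfl⟩ := IsIntegrallyClosed.isIntegral_iff.1 hx
  exact v.valuation_le_one y

theorem exists_unit_valuation_eq_exp_isIntegral {n : ℕ} (hn : n ≠ 0) {y : K} {z : ℤ}
    (h : WithZero.exp z ^ n * v.valuation K y ≤ 1) :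
    ∃ c : Kˣ, v.valuation K (c : K) = WithZero.exp z ∧ IsIntegral A ((c : K) ^ n * y) := by
  obtain ⟨π, hπ⟩ := v.valuation_exists_uniformizer K
  have hπz : v.valuation K (π ^ (-z)) = WithZero.exp z := by
    rw [map_zpow₀, hπ, ← WithZero.exp_zsmul, smul_eq_mul, neg_mul_neg, mul_one]
  rw [← hπz, ← map_pow, ← map_mul] at h
  obtain ⟨r, s, hrs⟩ := v.exists_primeCompl_mul_eq_of_integer _ h
  have hs : v.valuation K (algebraMap A K s) = 1 := v.valuation_eq_one_iff_notMem.2 s.2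
  have hc : v.valuation K (π ^ (-z) * algebraMap A K s) = WithZero.exp z := by
    rw [map_mul, hπz, hs, mul_one]
  have hc0 : π ^ (-z) * algebraMap A K s ≠ 0 := by
    rw [← Valuation.ne_zero_iff (v.valuation K), hc]
    exact WithZero.exp_ne_zero
  refine ⟨Units.mk0 _ hc0, hc, ?_⟩
  have hint : (π ^ (-z) * algebraMap A K s) ^ n * y = algebraMap A K (r * s ^ (n - 1)) := by
    rw [map_mul, ← hrs, map_pow, mul_assoc _ (algebraMap A K s), mul_pow_sub_one hn]
    ring
  rw [Units.val_mk0, hint]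
  exact isIntegral_algebraMap

variable {n : ℕ} {a : K}

theorem valuation_kummerBasis_repr_le [NeZero n] (hn : (n : K) ≠ 0) (ha : a ≠ 0)
    (hv : (n : A) ∉ v.asIdeal) {x : kummerAlgebra K n a} (hx : IsIntegral A x) (i : Fin n) :
    v.valuation K ((kummerBasis n a).repr x i) ≤ WithZero.exp ((i : ℤ) * ordAt v a / n) := by
  refine le_exp_ediv_of_pow_le_exp (NeZero.ne n) ?_
  have h := valuation_le_one_of_isIntegral v (isIntegral_natCast_mul_repr_pow_mul_pow hn hx i)
  rw [map_mul, map_pow, map_mul, map_pow, valuation_natCast_eq_one v hv, one_mul,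
    valuation_eq_exp_neg_ordAt v ha, ← WithZero.exp_nsmul, nsmul_eq_mul, mul_neg, WithZero.exp_neg,
    ← div_eq_mul_inv] at h
  exact (div_le_one₀ WithZero.exp_pos).1 h

theorem discrIdeal_kummerAlgebra_le_pow (hn : (n : K) ≠ 0) (ha : a ≠ 0)
    (hv : (n : A) ∉ v.asIdeal) :
    discrIdeal A K (kummerAlgebra K n a) ≤ v.asIdeal ^ (n - Int.gcd (ordAt v a) n) := by
  have hn0 : NeZero n := ⟨by rintro rfl; exact hn Nat.cast_zero⟩
  refine discrIdeal_le_pow (K := K) v fun b hb => ?_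
  refine (valuation_discr_le (v.valuation K) (kummerBasis n a) b
    fun j i => valuation_kummerBasis_repr_le v hn ha hv (hb j) i).trans_eq ?_
  rw [valuation_discr_kummerBasis, valuation_natCast_eq_one v hv, one_pow, one_mul,
    valuation_eq_exp_neg_ordAt v ha, prod_exp_mul_ediv_sq_mul hn0.out]

theorem exists_mem_discrIdeal_kummerAlgebra (hn : (n : K) ≠ 0) (ha : a ≠ 0) :
    ∃ d ∈ discrIdeal A K (kummerAlgebra K n a), v.valuation K (algebraMap A K d) =
      WithZero.exp (-((n - Int.gcd (ordAt v a) n : ℕ) : ℤ)) * v.valuation K n ^ n := by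
  have hn0 : NeZero n := ⟨by rintro rfl; exact hn Nat.cast_zero⟩
  have hscale (i : Fin n) :
      WithZero.exp ((i : ℤ) * ordAt v a / n) ^ n * v.valuation K (a ^ (i : ℕ)) ≤ 1 := by
    have hfloor := Int.ediv_mul_le ((i : ℤ) * ordAt v a) (Nat.cast_ne_zero.2 hn0.out : (n : ℤ) ≠ 0)
    rw [map_pow, valuation_eq_exp_neg_ordAt v ha, ← WithZero.exp_nsmul, ← WithZero.exp_nsmul,
      ← WithZero.exp_add, ← WithZero.exp_zero, WithZero.exp_le_exp, nsmul_eq_mul, nsmul_eq_mul]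
    linarith
  choose c hcv hcint using fun i => exists_unit_valuation_eq_exp_isIntegral v hn0.out (hscale i)
  have hbint := isIntegral_unitsSMul_kummerBasis hcint
  obtain ⟨d, hd⟩ := IsIntegrallyClosed.isIntegral_iff.1 (isIntegral_discr_kummerAlgebra hn hbint)
  refine ⟨d, mem_discrIdeal _ hbint hd, ?_⟩
  rw [hd, discr_unitsSMul, map_mul, map_pow, map_prod, valuation_discr_kummerBasis,
    ← prod_exp_mul_ediv_sq_mul hn0.out, valuation_eq_exp_neg_ordAt v ha]
  simp only [hcv]
  rw [mul_comm (v.valuation K (n : K) ^ n), mul_assoc]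

theorem discrIdeal_kummerAlgebra_ne_bot (hn : (n : K) ≠ 0) (ha : a ≠ 0) :
    discrIdeal A K (kummerAlgebra K n a) ≠ ⊥ := by
  have hn0 : NeZero n := ⟨by rintro rfl; exact hn Nat.cast_zero⟩
  obtain ⟨r, s, hs, rfl⟩ := IsFractionRing.div_surjective (A := A) a
  have hs0 : algebraMap A K s ≠ 0 := IsFractionRing.to_map_ne_zero_of_mem_nonZeroDivisors hs
  let c (i : Fin n) : Kˣ := Units.mk0 (algebraMap A K s) hs0 ^ (i : ℕ)
  have hc (i : Fin n) :
      IsIntegral A ((c i : K) ^ n * (algebraMap A K r / algebraMap A K s) ^ (i : ℕ)) := by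
    have hint : algebraMap A K s ^ n * (algebraMap A K r / algebraMap A K s) =
        algebraMap A K (s ^ (n - 1) * r) := by
      rw [map_mul, map_pow, ← pow_sub_one_mul hn0.out]
      field_simp
    rw [Units.val_pow_eq_pow_val, Units.val_mk0, pow_right_comm, ← mul_pow, hint]
    exact isIntegral_algebraMap.pow _
  have hbint := isIntegral_unitsSMul_kummerBasis hc
  obtain ⟨d, hd⟩ := IsIntegrallyClosed.isIntegral_iff.1 (isIntegral_discr_kummerAlgebra hn hbint)
  refine (Submodule.ne_bot_iff _).2 ⟨d, mem_discrIdeal _ hbint hd, ?_⟩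
  rintro rfl
  rw [map_zero, discr_unitsSMul] at hd
  refine mul_ne_zero ?_ (discr_kummerBasis_ne_zero hn ha) hd.symm
  exact pow_ne_zero _ (Finset.prod_ne_zero_iff.2 fun i _ => (c i).ne_zero)

end Local

section Multiplicity

variable {A : Type*} [CommRing A] [IsDedekindDomain A]

theorem eq_finprod_notMem_mul_finprod_mem {I : Ideal A} (hI : I ≠ ⊥)
    (P : HeightOneSpectrum A → Prop) :
    I = (∏ᶠ (v : HeightOneSpectrum A) (_ : ¬P v), v.asIdeal ^ multiplicity v.asIdeal I) *
      ∏ᶠ (v : HeightOneSpectrum A) (_ : P v), v.asIdeal ^ multiplicity v.asIdeal I := by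
  have hfin : Function.HasFiniteMulSupport fun v : HeightOneSpectrum A =>
      v.asIdeal ^ multiplicity v.asIdeal I := by
    simpa only [HeightOneSpectrum.maxPowDividing_eq_pow_multiplicity hI] using
      Ideal.hasFiniteMulSupport hI
  have hsplit := finprod_mem_mul_sdiff' (s := {v | ¬P v}) (Set.subset_univ _)
    (hfin.inter_of_right _)
  rw [finprod_mem_univ, Ideal.finprod_heightOneSpectrum_pow_multiplicity hI] at hsplit
  simp only [Set.mem_ofPred_eq, Set.mem_sdiff, Set.mem_univ, true_and, not_not] at hsplit
  exact hsplit.symm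

theorem exists_multiplicity_span_le {x : A} (hx : x ≠ 0) :
    ∃ B : ℕ, ∀ v : HeightOneSpectrum A, x ∈ v.asIdeal →
      multiplicity v.asIdeal (Ideal.span {x}) ≤ B := by
  have hfin : {v : HeightOneSpectrum A | v.asIdeal ∣ Ideal.span {x}}.Finite :=
    Ideal.finite_factors (by simpa using hx)
  obtain ⟨B, hB⟩ := (hfin.image fun v => multiplicity v.asIdeal (Ideal.span {x})).bddAbove
  exact ⟨B, fun v hv => hB ⟨v, Ideal.dvd_span_singleton.2 hv, rfl⟩⟩

variable {K : Type*} [Field K] [Algebra A K] [IsFractionRing A K] {n : ℕ} {a : K}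
  (v : HeightOneSpectrum A)

theorem multiplicity_discrIdeal_kummerAlgebra_le (hn : (n : K) ≠ 0) (ha : a ≠ 0) :
    multiplicity v.asIdeal (discrIdeal A K (kummerAlgebra K n a)) ≤
      n - Int.gcd (ordAt v a) n + n * multiplicity v.asIdeal (Ideal.span {(n : A)}) := by
  obtain ⟨d, hd, hval⟩ := exists_mem_discrIdeal_kummerAlgebra v hn ha
  have hnA : (n : A) ≠ 0 := fun h => hn (by rw [← map_natCast (algebraMap A K), h, map_zero])
  have hvn : ordAt v (n : K) = multiplicity v.asIdeal (Ideal.span {(n : A)}) := by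
    rw [← map_natCast (algebraMap A K), ordAt_algebraMap v hnA]
  rw [valuation_eq_exp_neg_ordAt v hn, hvn, ← WithZero.exp_nsmul, ← WithZero.exp_add] at hval
  have hd0 : d ≠ 0 := by
    rintro rfl
    rw [map_zero, map_zero] at hval
    exact WithZero.exp_ne_zero hval.symm
  have hvd := valuation_eq_exp_neg_ordAt v
    ((map_ne_zero_iff _ (IsFractionRing.injective A K)).2 hd0)
  rw [hval, ordAt_algebraMap v hd0, WithZero.exp_inj, nsmul_eq_mul] at hvd
  refine (HeightOneSpectrum.multiplicity_le_of_ideal_ge v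
    ((Ideal.span_singleton_le_iff_mem _).2 hd) (by simpa using hd0)).trans ?_
  zify
  linarith

theorem multiplicity_discrIdeal_kummerAlgebra (hn : (n : K) ≠ 0) (ha : a ≠ 0)
    (hv : (n : A) ∉ v.asIdeal) :
    multiplicity v.asIdeal (discrIdeal A K (kummerAlgebra K n a)) =
      n - Int.gcd (ordAt v a) n := by
  have hle := multiplicity_discrIdeal_kummerAlgebra_le v hn ha
  have hvn : multiplicity v.asIdeal (Ideal.span {(n : A)}) = 0 :=
    multiplicity_eq_zero.2 (mt Ideal.dvd_span_singleton.1 hv)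
  rw [hvn, mul_zero, add_zero] at hle
  refine hle.antisymm ?_
  have hfin := FiniteMultiplicity.of_prime_left v.prime
    (discrIdeal_kummerAlgebra_ne_bot (A := A) hn ha)
  exact hfin.pow_dvd_iff_le_multiplicity.1
    (Ideal.dvd_iff_le.2 (discrIdeal_kummerAlgebra_le_pow v hn ha hv))

theorem discrIdeal_kummerAlgebra_eq_finprod (hn : (n : K) ≠ 0) (ha : a ≠ 0) :
    discrIdeal A K (kummerAlgebra K n a) =
      (∏ᶠ (v : HeightOneSpectrum A) (_ : (n : A) ∉ v.asIdeal ∧ ordAt v a ≠ 0),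
          v.asIdeal ^ (n - Int.gcd (ordAt v a) n)) *
        ∏ᶠ (v : HeightOneSpectrum A) (_ : (n : A) ∈ v.asIdeal),
          v.asIdeal ^ multiplicity v.asIdeal (discrIdeal A K (kummerAlgebra K n a)) := by
  refine (eq_finprod_notMem_mul_finprod_mem (discrIdeal_kummerAlgebra_ne_bot hn ha)
    fun v => (n : A) ∈ v.asIdeal).trans (congrArg (· * _) (finprod_congr fun v => ?_))
  by_cases hv : (n : A) ∈ v.asIdeal
  · simp [hv]
  · have hmult := multiplicity_discrIdeal_kummerAlgebra v hn ha hv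
    by_cases hva : ordAt v a = 0
    · simp [hv, hva, hmult]
    · simp [hv, hva, hmult]

variable (A K) in
theorem exists_multiplicity_discrIdeal_kummerAlgebra_le (hn : (n : K) ≠ 0) :
    ∃ C : ℕ, 0 < C ∧ ∀ (a : K), a ≠ 0 → ∀ v : HeightOneSpectrum A, (n : A) ∈ v.asIdeal →
      multiplicity v.asIdeal (discrIdeal A K (kummerAlgebra K n a)) ≤ C := by
  have hnA : (n : A) ≠ 0 := fun h => hn (by rw [← map_natCast (algebraMap A K), h, map_zero])
  have hn0 : 0 < n := Nat.pos_of_ne_zero (by rintro rfl; exact hn Nat.cast_zero)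
  obtain ⟨B, hB⟩ := exists_multiplicity_span_le hnA
  exact ⟨n + n * B, by positivity, fun a ha v hv =>
    (multiplicity_discrIdeal_kummerAlgebra_le v hn ha).trans
      (add_le_add (Nat.sub_le _ _) (Nat.mul_le_mul_left n (hB v hv)))⟩

end Multiplicity

theorem mainTheorem4_general (A K : Type*) [CommRing A] [IsDedekindDomain A] [Field K]
    [Algebra A K] [IsFractionRing A K] {n : ℕ} (hn : (n : K) ≠ 0) :
    ∃ C : ℕ, 0 < C ∧ ∃ e : Kˣ → HeightOneSpectrum A → ℕ,
      (∀ (a : Kˣ) (v : HeightOneSpectrum A), (n : A) ∈ v.asIdeal → e a v ≤ C) ∧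
      ∀ a : Kˣ,
        discrIdeal A K (kummerAlgebra K n (a : K)) =
          (∏ᶠ (v : HeightOneSpectrum A) (_ : (n : A) ∉ v.asIdeal ∧ ordAt v (a : K) ≠ 0),
              v.asIdeal ^ (n - Int.gcd (ordAt v (a : K)) n)) *
            ∏ᶠ (v : HeightOneSpectrum A) (_ : (n : A) ∈ v.asIdeal), v.asIdeal ^ e a v := by
  obtain ⟨C, hC, hbound⟩ := exists_multiplicity_discrIdeal_kummerAlgebra_le A K hn
  exact ⟨C, hC, fun a v => multiplicity v.asIdeal (discrIdeal A K (kummerAlgebra K n (a : K))),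
    fun a => hbound a a.ne_zero, fun a => discrIdeal_kummerAlgebra_eq_finprod hn a.ne_zero⟩

section Integers

open Rat.HeightOneSpectrum

theorem asIdeal_eq_span_natGenerator (v : HeightOneSpectrum ℤ) :
    v.asIdeal = Ideal.span {(natGenerator v : ℤ)} := by
  have hid : ((Rat.IsIntegralClosure.intEquiv ℤ : ℤ ≃+* ℤ) : ℤ →+* ℤ) = RingHom.id ℤ :=
    Subsingleton.elim _ _
  rw [span_natGenerator]
  exact (v.asIdeal.map_id.symm.trans (by rw [← hid]; rfl))

theorem intCast_mem_asIdeal_iff {v : HeightOneSpectrum ℤ} {a : ℤ} :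
    a ∈ v.asIdeal ↔ natGenerator v ∣ a.natAbs := by
  rw [asIdeal_eq_span_natGenerator, Ideal.mem_span_singleton, Int.natCast_dvd]

theorem ordAt_intCast (v : HeightOneSpectrum ℤ) {a : ℤ} (ha : a ≠ 0) :
    ordAt v (a : ℚ) = padicValInt (natGenerator v) a := by
  rw [← eq_intCast (algebraMap ℤ ℚ), ordAt_algebraMap v ha, asIdeal_eq_span_natGenerator,
    padicValInt.of_ne_one_ne_zero (prime_natGenerator v).ne_one ha]
  exact congrArg (Nat.cast : ℕ → ℤ)
    (multiplicity_eq_of_emultiplicity_eq Ideal.emultiplicity_eq_emultiplicity_span)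

theorem exists_natGenerator_eq {p : ℕ} (hp : p.Prime) :
    ∃ v : HeightOneSpectrum ℤ, natGenerator v = p :=
  (primesEquiv.surjective ⟨p, hp⟩).imp fun _ hv => congrArg Subtype.val hv

theorem finprod_mem_asIdeal_eq_prod_primeFactors {M : Type*} [CommMonoid M] {a : ℤ} (ha : a ≠ 0)
    (f : ℕ → M) :
    ∏ᶠ (v : HeightOneSpectrum ℤ) (_ : a ∈ v.asIdeal), f (natGenerator v) =
      ∏ p ∈ a.natAbs.primeFactors, f p := by
  rw [← finprod_mem_coe_finset]
  refine finprod_mem_eq_of_bijOn (s := {v : HeightOneSpectrum ℤ | a ∈ v.asIdeal}) natGenerator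
    ⟨fun v hv => ?_, fun v _ w _ h => ?_, fun p hp => ?_⟩ fun _ _ => rfl
  · exact Nat.mem_primeFactors.2
      ⟨prime_natGenerator v, intCast_mem_asIdeal_iff.1 hv, Int.natAbs_ne_zero.2 ha⟩
  · exact (primesEquiv (R := ℤ)).injective (Subtype.ext h)
  · obtain ⟨v, rfl⟩ := exists_natGenerator_eq (Nat.prime_of_mem_primeFactors hp)
    exact ⟨v, intCast_mem_asIdeal_iff.2 (Nat.dvd_of_mem_primeFactors hp), rfl⟩

theorem prod_primeFactors_span_pow_of_squarefree {a : ℤ} (ha : Squarefree a) (n : ℕ) :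
    ∏ p ∈ a.natAbs.primeFactors, Ideal.span {(p : ℤ)} ^ (n - Nat.gcd (padicValInt p a) n) =
      Ideal.span {a} ^ (n - 1) := by
  have hsq : Squarefree a.natAbs := Int.squarefree_natAbs.2 ha
  have hval : ∀ p ∈ a.natAbs.primeFactors, padicValInt p a = 1 := fun p hp => by
    rw [padicValInt, ← Nat.factorization_def _ (Nat.prime_of_mem_primeFactors hp)]
    exact Nat.factorization_eq_one_of_squarefree hsq (Nat.prime_of_mem_primeFactors hp)
      (Nat.dvd_of_mem_primeFactors hp)
  rw [Finset.prod_congr rfl fun p hp => by rw [hval p hp, Nat.gcd_one_left], Finset.prod_pow,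
    Ideal.prod_span_singleton, ← Nat.cast_prod, Nat.prod_primeFactors_of_squarefree hsq,
    Int.span_natAbs]

theorem discrIdeal_kummerAlgebra_intCast {n : ℕ} (hn : n ≠ 0) {a : ℤ} (ha : a ≠ 0)
    (hcop : IsCoprime a n) :
    discrIdeal ℤ ℚ (kummerAlgebra ℚ n (a : ℚ)) =
      (∏ p ∈ a.natAbs.primeFactors,
          Ideal.span {(p : ℤ)} ^ (n - Nat.gcd (padicValInt p a) n)) *
        ∏ p ∈ n.primeFactors, Ideal.span {(p : ℤ)} ^
          multiplicity (Ideal.span {(p : ℤ)}) (discrIdeal ℤ ℚ (kummerAlgebra ℚ n (a : ℚ))) := by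
  have hiff : ∀ v : HeightOneSpectrum ℤ,
      (n : ℤ) ∉ v.asIdeal ∧ ordAt v (a : ℚ) ≠ 0 ↔ a ∈ v.asIdeal := fun v => by
    have hord : ordAt v (a : ℚ) ≠ 0 ↔ a ∈ v.asIdeal := by
      have := Fact.mk (prime_natGenerator v)
      rw [ordAt_intCast v ha, Nat.cast_ne_zero, intCast_mem_asIdeal_iff, padicValInt,
        dvd_iff_padicValNat_ne_zero (Int.natAbs_ne_zero.2 ha)]
    rw [hord, and_iff_right_iff_imp]
    intro hav hnv
    obtain ⟨x, y, hxy⟩ := hcop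
    exact v.isPrime.one_notMem
      (hxy ▸ add_mem (Ideal.mul_mem_left _ x hav) (Ideal.mul_mem_left _ y hnv))
  have hfinprod := discrIdeal_kummerAlgebra_eq_finprod (A := ℤ) (K := ℚ) (n := n) (a := a)
    (mod_cast hn) (mod_cast ha)
  have h1 := finprod_mem_asIdeal_eq_prod_primeFactors ha fun p =>
    Ideal.span {(p : ℤ)} ^ (n - Nat.gcd (padicValInt p a) n)
  have h2 := finprod_mem_asIdeal_eq_prod_primeFactors (a := n) (mod_cast hn) fun p =>
    Ideal.span {(p : ℤ)} ^
      multiplicity (Ideal.span {(p : ℤ)}) (discrIdeal ℤ ℚ (kummerAlgebra ℚ n (a : ℚ)))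
  rw [Int.natAbs_natCast] at h2
  rw [← h1, ← h2]
  simp only [hiff] at hfinprod
  simpa only [ordAt_intCast _ ha, Int.gcd_natCast_natCast,
    ← asIdeal_eq_span_natGenerator] using hfinprod

theorem exists_multiplicity_discrIdeal_kummerAlgebra_intCast_le {n : ℕ} (hn : n ≠ 0) :
    ∃ C : ℕ, 0 < C ∧ ∀ a : ℤ, a ≠ 0 → ∀ p ∈ n.primeFactors,
      multiplicity (Ideal.span {(p : ℤ)}) (discrIdeal ℤ ℚ (kummerAlgebra ℚ n (a : ℚ))) ≤ C := by
  obtain ⟨C, hC, hbound⟩ := exists_multiplicity_discrIdeal_kummerAlgebra_le ℤ ℚ (n := n)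
    (mod_cast hn)
  refine ⟨C, hC, fun a ha p hp => ?_⟩
  obtain ⟨v, rfl⟩ := exists_natGenerator_eq (Nat.prime_of_mem_primeFactors hp)
  rw [← asIdeal_eq_span_natGenerator]
  exact hbound a (mod_cast ha) v (intCast_mem_asIdeal_iff.2 (Nat.dvd_of_mem_primeFactors hp))

end Integers

section Irreducible

theorem isEisensteinAt_X_pow_sub_C {R : Type*} [CommRing R] {p a : R} {n : ℕ} (hn : n ≠ 0)
    (hp : Prime p) (hpa : p ∣ a) (hpa2 : ¬p ^ 2 ∣ a) :
    (X ^ n - C a : R[X]).IsEisensteinAt (Ideal.span {p}) := by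
  have : Nontrivial R := ⟨⟨p, 0, hp.ne_zero⟩⟩
  refine (monic_X_pow_sub_C a hn).isEisensteinAt_of_mem_of_notMem
    (mt Ideal.span_singleton_eq_top.1 hp.not_isUnit) (fun hk => ?_) ?_
  · rw [natDegree_X_pow_sub_C] at hk
    rw [Ideal.mem_span_singleton, coeff_sub, coeff_X_pow, if_neg hk.ne, coeff_C, zero_sub, dvd_neg]
    split_ifs
    exacts [hpa, dvd_zero p]
  · rwa [coeff_sub, coeff_X_pow, if_neg hn.symm, coeff_C_zero, zero_sub, Ideal.span_singleton_pow,
      Ideal.mem_span_singleton, dvd_neg]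

theorem irreducible_X_pow_sub_C_algebraMap {R : Type*} (K : Type*) [CommRing R] [IsDomain R]
    [IsIntegrallyClosed R] [Field K] [Algebra R K] [IsFractionRing R K] {p a : R} {n : ℕ}
    (hn : n ≠ 0) (hp : Prime p) (hpa : p ∣ a) (hpa2 : ¬p ^ 2 ∣ a) :
    Irreducible (X ^ n - C (algebraMap R K a) : K[X]) := by
  have hmonic : (X ^ n - C a : R[X]).Monic := monic_X_pow_sub_C a hn
  have hirr : Irreducible (X ^ n - C a : R[X]) :=
    (isEisensteinAt_X_pow_sub_C hn hp hpa hpa2).irreducible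
      ((Ideal.span_singleton_prime hp.ne_zero).2 hp) hmonic.isPrimitive
      (by rw [natDegree_X_pow_sub_C]; exact Nat.pos_of_ne_zero hn)
  simpa only [Polynomial.map_sub, Polynomial.map_pow, map_X, map_C] using
    (hmonic.irreducible_iff_irreducible_map_fraction_map (K := K)).1 hirr

theorem isField_kummerAlgebra {K : Type*} [Field K] {n : ℕ} {a : K}
    (h : Irreducible (X ^ n - C a : K[X])) : IsField (kummerAlgebra K n a) :=
  have : Fact (Irreducible (X ^ n - C a : K[X])) := ⟨h⟩
  Field.toIsField _

theorem isField_kummerAlgebra_intCast {n : ℕ} (hn : n ≠ 0) {a : ℤ} (ha : Squarefree a)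
    (h1 : a ≠ 1) (h2 : a ≠ -1) : IsField (kummerAlgebra ℚ n (a : ℚ)) := by
  obtain ⟨p, hp, hpa⟩ := Nat.exists_prime_and_dvd (n := a.natAbs) (by omega)
  have hpZ : Prime (p : ℤ) := Nat.prime_iff_prime_int.1 hp
  have hirr := irreducible_X_pow_sub_C_algebraMap ℚ hn hpZ (Int.natCast_dvd.2 hpa) fun h =>
    hpZ.not_isUnit (ha _ (sq (p : ℤ) ▸ h))
  rw [eq_intCast] at hirr
  exact isField_kummerAlgebra hirr

end Irreducible

theorem mainTheorem4 (n : ℕ) (hn : 0 < n) :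
    (∀ (K : Type*) [Field K] [NumberField K],
      ∃ C : ℕ, 0 < C ∧ ∃ e : Kˣ → HeightOneSpectrum (𝓞 K) → ℕ,
        (∀ (a : Kˣ) (v : HeightOneSpectrum (𝓞 K)), (n : 𝓞 K) ∈ v.asIdeal → e a v ≤ C) ∧
        ∀ a : Kˣ,
          discrIdeal (𝓞 K) K (kummerAlgebra K n (a : K)) =
            (∏ᶠ (v : HeightOneSpectrum (𝓞 K)) (_ : (n : 𝓞 K) ∉ v.asIdeal ∧ placeOrd v a ≠ 0),
                v.asIdeal ^ (n - Int.gcd (placeOrd v a) n)) *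
              ∏ᶠ (v : HeightOneSpectrum (𝓞 K)) (_ : (n : 𝓞 K) ∈ v.asIdeal),
                v.asIdeal ^ e a v) ∧
    (∃ C : ℕ, 0 < C ∧ ∃ e : ℤ → ℕ → ℕ,
      (∀ (a : ℤ) (p : ℕ), p ∈ n.primeFactors → e a p ≤ C) ∧
      ∀ a : ℤ, a ≠ 0 → IsCoprime a (n : ℤ) →
        discrIdeal ℤ ℚ (kummerAlgebra ℚ n (a : ℚ)) =
            (∏ p ∈ a.natAbs.primeFactors,
                Ideal.span {(p : ℤ)} ^ (n - Nat.gcd (padicValInt p a) n)) *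
              ∏ p ∈ n.primeFactors, Ideal.span {(p : ℤ)} ^ e a p ∧
        (Squarefree a →
          discrIdeal ℤ ℚ (kummerAlgebra ℚ n (a : ℚ)) =
            Ideal.span {a} ^ (n - 1) * ∏ p ∈ n.primeFactors, Ideal.span {(p : ℤ)} ^ e a p) ∧
        (Squarefree a → a ≠ 1 → a ≠ -1 → IsField (kummerAlgebra ℚ n (a : ℚ)))) := by
  have hn' : n ≠ 0 := hn.ne'
  refine ⟨fun K _ _ => mainTheorem4_general (𝓞 K) K (mod_cast hn'), ?_⟩
  obtain ⟨C, hC, hbound⟩ := exists_multiplicity_discrIdeal_kummerAlgebra_intCast_le hn'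
  -- The bound on `e` is also required at `a = 0`, where the discriminant ideal may vanish.
  refine ⟨C, hC, fun a p => if a = 0 then 0 else
    multiplicity (Ideal.span {(p : ℤ)}) (discrIdeal ℤ ℚ (kummerAlgebra ℚ n (a : ℚ))),
    fun a p hp => ?_, fun a ha hcop => ?_⟩
  · dsimp only
    split_ifs with ha
    exacts [Nat.zero_le C, hbound a ha p hp]
  · simp only [if_neg ha]
    have h := discrIdeal_kummerAlgebra_intCast hn' ha hcop
    exact ⟨h, fun hsq => by rwa [prod_primeFactors_span_pow_of_squarefree hsq] at h,
      isField_kummerAlgebra_intCast hn'⟩
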